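/- A $\mathsf{Pos}$-category is a category whose hom-sets are partially ordered, with composition monotone in both variables; a $\mathsf{Pos}$-functor is a functor that is monotone on hom-posets, and an equivalence $\simeq$ of $\mathsf{Pos}$-categories is an equivalence of categories both of whose functors are $\mathsf{Pos}$-functors. Full subcategories carry the induced order. A limit of $D\colon\mathcal D\to\mathcal C$ weighted by $W\colon\mathcal D\to\mathsf{Pos}$ is finite if $\mathcal D$ has finitely many isomorphism classes of objects, all $\mathcal D(d,d')$ are finite and all $Wd$ are finite. A weak $W$-weighted limit of $D$ is an object $L$ with a natural transformation $W\to\mathcal C(L,D-)$ such that the induced maps $\mathcal C(X,L)\to[\mathcal D,\mathsf{Pos}](W,\mathcal C(X,D-))$ are surjective (for a limit: isomorphisms of posets). $\mathcal C$ is weakly lex if it has all finite weak weighted limits. A morphism $m\colon X\to Y$ is an $\mathsf{ff}$-morphism (order-monomorphism) if $mu\le mv$ implies $u\le v$. A morphism $e\colon A\to B$ is an $\mathsf{so}$-morphism if for every $\mathsf{ff}$-morphism $m\colon X\to Y$ the square formed by $\mathcal C(B,X)$, $\mathcal C(A,X)$, $\mathcal C(B,Y)$, $\mathcal C(A,Y)$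 is a pullback of posets. $\mathcal C$ is regular if it has all finite weighted limits, every morphism factors as an $\mathsf{so}$-morphism followed by an $\mathsf{ff}$-morphism, and $\mathsf{so}$-morphisms are stable under pullback. A congruence on $X$ is a jointly order-monic pair $r_0,r_1\colon R\to X$ which, as a relation on generalized elements of $X$, is reflexive, transitive and an order-ideal (if $(x,y)\in_A R$, $x'\le x$ and $y\le y'$, then $(x',y')\in_A R$). $\mathcal C$ is exact if it is regular and every congruence is the comma object $f/f$ of some morphism $f$ with itself. An object $P$ is $\mathsf{so}$-projective if every morphism $P\to B$ lifts through every $\mathsf{so}$-morphism $A\to B$. A full subcategory $\mathcal P$ of a regular category $\mathcal E$ is a projective cover of $\mathcal E$ if every object of $\mathcal P$ is $\mathsf{so}$-projective in $\mathcal E$ and every object of $\mathcal E$ receives an $\mathsf{so}$-morphism from an object of $\mathcal P$. For a weakly lex $\mathcal C$, the exact completion $\mathcal C_{\rm ex}$ is the following $\mathsf{Pos}$-category. Its objects $(X,R)$ are the pseudocongruences in $\mathcal C$: pairs $r_0,r_1\colon R\to X$ such that every pair $a_0\le a_1\colon A\to X$ factors through $(r_0,r_1)$, and such that for a weak pullback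 $d_0,d_1\colon R*R\to R$ of $r_1$ and $r_0$ (so $r_1d_0=r_0d_1$) there is $\tau\colon R*R\to R$ with $r_0\tau=r_0d_0$ and $r_1\tau=r_1d_1$. Morphisms $(X,R)\to(Y,S)$ are represented by those $f\colon X\to Y$ for which there is $\bar f\colon R\to S$ with $s_0\bar f=fr_0$ and $s_1\bar f=fr_1$. These are preordered by $f\preccurlyeq g$ iff there is $\Sigma\colon X\to S$ with $s_0\Sigma=f$ and $s_1\Sigma=g$; hom-posets are the posetal quotients, and composition is induced by that of $\mathcal C$. **Theorem.** Let $\mathcal E$ be an exact $\mathsf{Pos}$-category and let $\mathcal P$ be a projective cover of $\mathcal E$. Then $\mathcal P$ is weakly lex and $\mathcal P_{\rm ex}\simeq\mathcal E$. Consequently, if $\mathcal E$ and $\mathcal F$ are exact $\mathsf{Pos}$-categories with projective covers $\mathcal P$ and $\mathcal Q$ respectively, and $\mathcal P\simeq\mathcal Q$, then $\mathcal E\simeq\mathcal F$. -/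

import Mathlib

open CategoryTheory

universe v₁ v₂ u₁ u₂

namespace PosEnriched

/-! ## Poset-enriched categories -/

/-- A `Pos`-category: every hom-set is partially ordered and composition is monotone in both
variables. -/
class PosCategory (C : Type u₁) [Category.{v₁} C] where
  homOrder : ∀ X Y : C, PartialOrder (X ⟶ Y)
  comp_le_comp : ∀ {X Y Z : C} {f f' : X ⟶ Y} {g g' : Y ⟶ Z},
    (homOrder X Y).le f f' → (homOrder Y Z).le g g' → (homOrder X Z).le (f ≫ g) (f' ≫ g')

instance homPartialOrder {C : Type u₁} [Category.{v₁} C] [PosCategory C] (X Y : C) :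
    PartialOrder (X ⟶ Y) :=
  PosCategory.homOrder X Y

theorem comp_mono {C : Type u₁} [Category.{v₁} C] [PosCategory C] {X Y Z : C}
    {f f' : X ⟶ Y} {g g' : Y ⟶ Z} (hf : f ≤ f') (hg : g ≤ g') : f ≫ g ≤ f' ≫ g' :=
  PosCategory.comp_le_comp hf hg

/-- A `Pos`-functor is a functor which is monotone on hom-posets. -/
def LocallyMonotone {C : Type u₁} [Category.{v₁} C] [PosCategory C]
    {D : Type u₂} [Category.{v₂} D] [PosCategory D] (F : C ⥤ D) : Prop :=
  ∀ ⦃X Y : C⦄ ⦃f g : X ⟶ Y⦄, f ≤ g → F.map f ≤ F.map g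

/-- An equivalence of `Pos`-categories: an equivalence both of whose functors are `Pos`-functors.
(There is no further condition on the unit and counit, since a `Pos`-natural transformation
between `Pos`-functors is just a natural transformation.) -/
structure PosEquivalence (C : Type u₁) [Category.{v₁} C] [PosCategory C]
    (D : Type u₂) [Category.{v₂} D] [PosCategory D] where
  equiv : C ≌ D
  functor_mono : LocallyMonotone equiv.functor
  inverse_mono : LocallyMonotone equiv.inverse

/-- A full subcategory of a `Pos`-category is a `Pos`-category with the same hom-posets. -/
instance fullSubcategoryPosCategory {C : Type u₁} [Category.{v₁} C] [PosCategory C]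
    (P : ObjectProperty C) : PosCategory P.FullSubcategory where
  homOrder X Y := PartialOrder.lift (fun f : X ⟶ Y => f.hom) (fun _ _ h => P.hom_ext h)
  comp_le_comp := fun {_ _ _ f f' g g'} hf hg =>
    comp_mono (f := f.hom) (f' := f'.hom) (g := g.hom) (g' := g'.hom) hf hg

/-- The category of posets and monotone maps, with the pointwise order on monotone maps. -/
instance partOrdPosCategory : PosCategory PartOrd.{u₁} where
  homOrder X Y := PartialOrder.lift (fun f : X ⟶ Y => f.hom) (fun _ _ h => PartOrd.hom_ext h)
  comp_le_comp := fun {_ _ _ f _ _ g'} hf hg x => (hg (f x)).trans (g'.hom.monotone (hf x))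

/-! ## Finite weighted limits, strong and weak -/

section Limits

variable {C : Type u₁} [Category.{v₁} C] [PosCategory C]

/-- A natural transformation `W ⟶ C(X, D-)` of `Pos`-valued functors, i.e. a `W`-weighted cone
over `D` with vertex `X`. -/
structure WeightedCone {J : Type} [Category.{0} J] (W : J ⥤ PartOrd.{0}) (D : J ⥤ C) (X : C) where
  leg : ∀ j : J, W.obj j → (X ⟶ D.obj j)
  leg_mono : ∀ j : J, Monotone (leg j)
  naturality : ∀ ⦃i j : J⦄ (f : i ⟶ j) (w : W.obj i), leg j (W.map f w) = leg i w ≫ D.map f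

/-- `c` exhibits `L` as a weak `W`-weighted limit of `D`: for each `X` the monotone map from
`C(X, L)` to the poset of weighted cones with vertex `X` is surjective. -/
def IsWeakWeightedLimit {J : Type} [Category.{0} J] {W : J ⥤ PartOrd.{0}} {D : J ⥤ C} {L : C}
    (c : WeightedCone W D L) : Prop :=
  ∀ (X : C) (a : WeightedCone W D X), ∃ h : X ⟶ L, ∀ j w, h ≫ c.leg j w = a.leg j w

/-- `c` exhibits `L` as the `W`-weighted limit of `D`: for each `X` the monotone map from
`C(X, L)` to the poset of weighted cones with vertex `X` is an isomorphism of posets, i.e. it is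
surjective and reflects the order. -/
def IsWeightedLimit {J : Type} [Category.{0} J] {W : J ⥤ PartOrd.{0}} {D : J ⥤ C} {L : C}
    (c : WeightedCone W D L) : Prop :=
  IsWeakWeightedLimit c ∧
    ∀ (X : C) (h h' : X ⟶ L), (∀ j w, h ≫ c.leg j w ≤ h' ≫ c.leg j w) → h ≤ h'

/-- A finite weight: finitely many isomorphism classes of objects in the domain, all of whose
hom-posets are finite, and finite values. -/
structure IsFiniteWeight {J : Type} [Category.{0} J] [PosCategory J] (W : J ⥤ PartOrd.{0}) :
    Prop where
  locallyMonotone : LocallyMonotone W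
  finite_objects : Finite (Quotient (isIsomorphicSetoid J))
  finite_homs : ∀ i j : J, Finite (i ⟶ j)
  finite_values : ∀ j : J, Finite (W.obj j)

variable (C)

/-- `C` has all finite (weighted) limits. -/
def HasFiniteWeightedLimits : Prop :=
  ∀ (J : Type) [Category.{0} J] [PosCategory J] (W : J ⥤ PartOrd.{0}) (D : J ⥤ C),
    IsFiniteWeight W → LocallyMonotone D →
      ∃ (L : C) (c : WeightedCone W D L), IsWeightedLimit c

/-- `C` is weakly lex: it has all finite weak (weighted) limits. -/
class WeaklyLex : Prop where
  exists_weakLimit : ∀ (J : Type) [Category.{0} J] [PosCategory J]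
    (W : J ⥤ PartOrd.{0}) (D : J ⥤ C), IsFiniteWeight W → LocallyMonotone D →
      ∃ (L : C) (c : WeightedCone W D L), IsWeakWeightedLimit c

variable {C}

/-- The square `p ≫ f = q ≫ g` is a weak pullback. -/
structure IsWeakPullback {L X Y Z : C} (p : L ⟶ X) (q : L ⟶ Y) (f : X ⟶ Z) (g : Y ⟶ Z) :
    Prop where
  w : p ≫ f = q ≫ g
  lift : ∀ {A : C} (a : A ⟶ X) (b : A ⟶ Y), a ≫ f = b ≫ g → ∃ u : A ⟶ L, u ≫ p = a ∧ u ≫ q = b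

/-- The square `p ≫ f = q ≫ g` is a pullback in the enriched sense: the legs are moreover jointly
order-monomorphic. -/
structure IsPosPullback {L X Y Z : C} (p : L ⟶ X) (q : L ⟶ Y) (f : X ⟶ Z) (g : Y ⟶ Z) : Prop
    extends IsWeakPullback p q f g where
  le_of_le : ∀ {A : C} (u u' : A ⟶ L), u ≫ p ≤ u' ≫ p → u ≫ q ≤ u' ≫ q → u ≤ u'

/-- The lax square `p ≫ f ≤ q ≫ g` is a comma square, i.e. `L` is the comma object `f/g`. -/
structure IsComma {L X Y Z : C} (p : L ⟶ X) (q : L ⟶ Y) (f : X ⟶ Z) (g : Y ⟶ Z) : Prop where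
  w : p ≫ f ≤ q ≫ g
  lift : ∀ {A : C} (a : A ⟶ X) (b : A ⟶ Y), a ≫ f ≤ b ≫ g → ∃ u : A ⟶ L, u ≫ p = a ∧ u ≫ q = b
  le_of_le : ∀ {A : C} (u u' : A ⟶ L), u ≫ p ≤ u' ≫ p → u ≫ q ≤ u' ≫ q → u ≤ u'

end Limits

/-! ## Regular and exact categories, projective covers -/

section Exact

variable {C : Type u₁} [Category.{v₁} C] [PosCategory C]

/-- `ff`-morphisms, also called order-monomorphisms. -/
def IsFF {X Y : C} (m : X ⟶ Y) : Prop :=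
  ∀ ⦃Z : C⦄ (u v : Z ⟶ X), u ≫ m ≤ v ≫ m → u ≤ v

/-- `so`-morphisms: for every order-monomorphism `m : X ⟶ Y`, the square of posets formed by
`C(B, X)`, `C(A, X)`, `C(B, Y)`, `C(A, Y)` is a pullback, i.e. the comparison map from `C(B, X)`
to the pullback is surjective and reflects the (componentwise) order. -/
def IsSO {A B : C} (e : A ⟶ B) : Prop :=
  ∀ ⦃X Y : C⦄ (m : X ⟶ Y), IsFF m →
    (∀ (a : A ⟶ X) (b : B ⟶ Y), a ≫ m = e ≫ b → ∃ d : B ⟶ X, e ≫ d = a ∧ d ≫ m = b) ∧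
    (∀ d d' : B ⟶ X, e ≫ d ≤ e ≫ d' → d ≫ m ≤ d' ≫ m → d ≤ d')

variable (C) in
/-- Regular `Pos`-categories. -/
structure IsRegular : Prop where
  lex : HasFiniteWeightedLimits C
  factorization : ∀ {X Y : C} (f : X ⟶ Y),
    ∃ (I : C) (e : X ⟶ I) (m : I ⟶ Y), IsSO e ∧ IsFF m ∧ e ≫ m = f
  so_stable : ∀ {L X Y Z : C} {p : L ⟶ X} {q : L ⟶ Y} {f : X ⟶ Z} {g : Y ⟶ Z},
    IsPosPullback p q f g → IsSO f → IsSO q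

/-- `(x, y) ∈_A R`: the pair `(x, y)` of morphisms `A ⟶ X` factors through `(r₀, r₁)`. -/
def Factors {R X A : C} (r₀ r₁ : R ⟶ X) (x y : A ⟶ X) : Prop :=
  ∃ u : A ⟶ R, u ≫ r₀ = x ∧ u ≫ r₁ = y

/-- A congruence on `X`: a relation (given by a jointly order-monic pair `r₀, r₁ : R ⟶ X`, that
is, an order-mono `R ⟶ X × X`) which is reflexive, transitive and an order-ideal. -/
structure IsCongruence {R X : C} (r₀ r₁ : R ⟶ X) : Prop where
  jointly_ff : ∀ {A : C} (u v : A ⟶ R), u ≫ r₀ ≤ v ≫ r₀ → u ≫ r₁ ≤ v ≫ r₁ → u ≤ v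
  refl : Factors r₀ r₁ (𝟙 X) (𝟙 X)
  trans : ∀ {A : C} (x y z : A ⟶ X), Factors r₀ r₁ x y → Factors r₀ r₁ y z → Factors r₀ r₁ x z
  orderIdeal : ∀ {A : C} (x y x' y' : A ⟶ X),
    Factors r₀ r₁ x y → x' ≤ x → y ≤ y' → Factors r₀ r₁ x' y'

variable (C) in
/-- Exact `Pos`-categories: regular, and every congruence is effective, that is, the kernel
congruence `f/f` of some morphism `f`. -/
structure IsExact : Prop extends IsRegular C where
  effective : ∀ {R X : C} (r₀ r₁ : R ⟶ X), IsCongruence r₀ r₁ →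
    ∃ (Y : C) (f : X ⟶ Y), IsComma r₀ r₁ f f

/-- `so`-projective objects. -/
def IsSOProjective (P : C) : Prop :=
  ∀ ⦃A B : C⦄ (e : A ⟶ B), IsSO e → ∀ f : P ⟶ B, ∃ g : P ⟶ A, g ≫ e = f

/-- The full subcategory on the objects satisfying `P` is a projective cover. -/
structure IsProjectiveCover (P : ObjectProperty C) : Prop where
  projective : ∀ X : C, P X → IsSOProjective X
  enough : ∀ A : C, ∃ (X : C) (e : X ⟶ A), P X ∧ IsSO e

end Exact

/-! ## Weak pullbacks in weakly lex categories -/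

section WeakPullback

open Limits

/-- The walking cospan with discrete hom-posets. -/
instance walkingCospanPosCategory : PosCategory WalkingCospan where
  homOrder X Y :=
    { le := fun f g => f = g
      le_refl := fun _ => rfl
      le_trans := fun _ _ _ h h' => h.trans h'
      le_antisymm := fun _ _ h _ => h }
  comp_le_comp := fun _ _ => Subsingleton.elim _ _

variable {C : Type u₁} [Category.{v₁} C] [PosCategory C]

theorem exists_weakPullback [WeaklyLex C] {X Y Z : C} (f : X ⟶ Z) (g : Y ⟶ Z) :
    ∃ (L : C) (p : L ⟶ X) (q : L ⟶ Y), IsWeakPullback p q f g := by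
  let W : WalkingCospan ⥤ PartOrd.{0} := (Functor.const _).obj (PartOrd.of PUnit)
  have hW : IsFiniteWeight W :=
    { locallyMonotone := fun _ _ _ _ _ => le_refl _
      finite_objects := inferInstance
      finite_homs := fun _ _ => inferInstance
      finite_values := fun _ => inferInstanceAs (Finite PUnit) }
  have hD : LocallyMonotone (cospan f g) := by
    intro i j a b _
    rw [Subsingleton.elim a b]
  obtain ⟨L, c, hc⟩ := WeaklyLex.exists_weakLimit WalkingCospan W (cospan f g) hW hD
  have hl := c.naturality WalkingCospan.Hom.inl PUnit.unit
  have hr := c.naturality WalkingCospan.Hom.inr PUnit.unit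
  refine ⟨L, c.leg .left PUnit.unit, c.leg .right PUnit.unit, ⟨hl.symm.trans hr, ?_⟩⟩
  intro A a b hab
  let d : WeightedCone W (cospan f g) A :=
    { leg := fun j _ => match j with
        | .left => a
        | .right => b
        | .one => a ≫ f
      leg_mono := fun _ _ _ _ => le_refl _
      naturality := by
        intro i j k _
        rcases k with _ | (_ | _)
        · simp
        · rfl
        · exact hab }
  obtain ⟨u, hu⟩ := hc A d
  exact ⟨u, hu .left PUnit.unit, hu .right PUnit.unit⟩

end WeakPullback

/-! ## The exact completion of a weakly lex category -/

section ExactCompletion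

/-- A pseudocongruence `r₀, r₁ : R ⟶ X`. -/
structure Pseudocongruence (C : Type u₁) [Category.{v₁} C] [PosCategory C] where
  X : C
  R : C
  r₀ : R ⟶ X
  r₁ : R ⟶ X
  orderReflexive : ∀ {A : C} (a₀ a₁ : A ⟶ X), a₀ ≤ a₁ → Factors r₀ r₁ a₀ a₁
  transitive : ∀ {RR : C} (d₀ d₁ : RR ⟶ R), IsWeakPullback d₀ d₁ r₁ r₀ →
    ∃ τ : RR ⟶ R, τ ≫ r₀ = d₀ ≫ r₀ ∧ τ ≫ r₁ = d₁ ≫ r₁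

/-- The objects of the exact completion of a weakly lex `Pos`-category `C` are the
pseudocongruences in `C`. -/
structure ExactCompletion (C : Type u₁) [Category.{v₁} C] [PosCategory C] [WeaklyLex C] extends
  Pseudocongruence C

variable {C : Type u₁} [Category.{v₁} C] [PosCategory C]

/-- The morphisms `f : X ⟶ Y` of `C` which represent morphisms `(X, R) ⟶ (Y, S)` of the exact
completion. -/
structure PreHom (A B : Pseudocongruence C) where
  f : A.X ⟶ B.X
  compat : ∃ fbar : A.R ⟶ B.R, fbar ≫ B.r₀ = A.r₀ ≫ f ∧ fbar ≫ B.r₁ = A.r₁ ≫ f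

theorem Pseudocongruence.factors_trans [WeaklyLex C] (S : Pseudocongruence C) {A : C}
    {x y z : A ⟶ S.X} (h : Factors S.r₀ S.r₁ x y) (h' : Factors S.r₀ S.r₁ y z) :
    Factors S.r₀ S.r₁ x z := by
  obtain ⟨u, hu₀, hu₁⟩ := h
  obtain ⟨v, hv₀, hv₁⟩ := h'
  obtain ⟨RR, d₀, d₁, hd⟩ := exists_weakPullback S.r₁ S.r₀
  obtain ⟨τ, hτ₀, hτ₁⟩ := S.transitive d₀ d₁ hd
  obtain ⟨w, hw₀, hw₁⟩ := hd.lift u v (hu₁.trans hv₀.symm)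
  refine ⟨w ≫ τ, ?_, ?_⟩
  · rw [Category.assoc, hτ₀, ← Category.assoc, hw₀, hu₀]
  · rw [Category.assoc, hτ₁, ← Category.assoc, hw₁, hv₁]

/-- `f ≼ g` iff there is `Σ : X ⟶ S` with `s₀ Σ = f` and `s₁ Σ = g`. -/
instance preHomPreorder [WeaklyLex C] (A B : Pseudocongruence C) : Preorder (PreHom A B) where
  le f g := Factors B.r₀ B.r₁ f.f g.f
  le_refl f := B.orderReflexive f.f f.f (le_refl _)
  le_trans _ _ _ h h' := B.factors_trans h h'

def PreHom.id (A : Pseudocongruence C) : PreHom A A where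
  f := 𝟙 A.X
  compat := ⟨𝟙 A.R, by simp, by simp⟩

def PreHom.comp {A B D : Pseudocongruence C} (f : PreHom A B) (g : PreHom B D) : PreHom A D where
  f := f.f ≫ g.f
  compat := by
    obtain ⟨a, ha₀, ha₁⟩ := f.compat
    obtain ⟨b, hb₀, hb₁⟩ := g.compat
    refine ⟨a ≫ b, ?_, ?_⟩
    · rw [Category.assoc, hb₀, ← Category.assoc, ha₀, Category.assoc]
    · rw [Category.assoc, hb₁, ← Category.assoc, ha₁, Category.assoc]

theorem PreHom.comp_le_comp [WeaklyLex C] {A B D : Pseudocongruence C} {f f' : PreHom A B}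
    {g g' : PreHom B D} (hf : f ≤ f') (hg : g ≤ g') : f.comp g ≤ f'.comp g' := by
  have h₁ : f.comp g ≤ f'.comp g := by
    obtain ⟨s, hs₀, hs₁⟩ := hf
    obtain ⟨b, hb₀, hb₁⟩ := g.compat
    refine ⟨s ≫ b, ?_, ?_⟩
    · rw [Category.assoc, hb₀, ← Category.assoc, hs₀]; rfl
    · rw [Category.assoc, hb₁, ← Category.assoc, hs₁]; rfl
  have h₂ : f'.comp g ≤ f'.comp g' := by
    obtain ⟨s, hs₀, hs₁⟩ := hg
    refine ⟨f'.f ≫ s, ?_, ?_⟩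
    · rw [Category.assoc, hs₀]; rfl
    · rw [Category.assoc, hs₁]; rfl
  exact h₁.trans h₂

/-- Morphisms of the exact completion are equivalence classes of representing morphisms of `C`
for the equivalence relation `f ≼ g ∧ g ≼ f`. -/
instance exactCompletionCategory [WeaklyLex C] : Category.{v₁} (ExactCompletion C) where
  Hom A B := Antisymmetrization (PreHom A.toPseudocongruence B.toPseudocongruence) (· ≤ ·)
  id A := toAntisymmetrization (· ≤ ·) (PreHom.id A.toPseudocongruence)
  comp := Quotient.map₂ PreHom.comp
    (fun _ _ hf _ _ hg => ⟨PreHom.comp_le_comp hf.1 hg.1, PreHom.comp_le_comp hf.2 hg.2⟩)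
  id_comp := by
    rintro A B ⟨f⟩
    exact congrArg (toAntisymmetrization (· ≤ ·))
      (by cases f; simp [PreHom.comp, PreHom.id] : PreHom.comp (PreHom.id _) f = f)
  comp_id := by
    rintro A B ⟨f⟩
    exact congrArg (toAntisymmetrization (· ≤ ·))
      (by cases f; simp [PreHom.comp, PreHom.id] : PreHom.comp f (PreHom.id _) = f)
  assoc := by
    rintro A B D E ⟨f⟩ ⟨g⟩ ⟨h⟩
    exact congrArg (toAntisymmetrization (· ≤ ·))
      (by simp [PreHom.comp] : (f.comp g).comp h = f.comp (g.comp h))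

/-- The exact completion is a `Pos`-category, with `[f] ≤ [g]` iff `f ≼ g`. -/
instance exactCompletionPosCategory [WeaklyLex C] : PosCategory (ExactCompletion C) where
  homOrder A B := inferInstanceAs (PartialOrder (Antisymmetrization (PreHom A.toPseudocongruence B.toPseudocongruence) (· ≤ ·)))
  comp_le_comp := by
    rintro A B D ⟨f⟩ ⟨f'⟩ ⟨g⟩ ⟨g'⟩ hf hg
    exact PreHom.comp_le_comp hf hg

end ExactCompletion

end PosEnriched

/-! Every object `A` of an exact category is the quotient of a projective `G X` by an order kernel,
and that kernel is in turn covered by some `G R`; the pair `R ⟶ X` is a pseudocongruence.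
Conversely, the image of `G R` in `G X × G X` is a congruence, so by exactness it is the order
kernel of an `so`-morphism `q`. Both constructions are governed by one condition, `IsQuotient`: a
pair `x, y` factors through `R` iff `G x ≫ q ≤ G y ≫ q`.

Morphisms of quotients lift to representatives by projectivity (`exists_preHom`), and
representatives descend because `q` is the quotient of its order kernel (`exists_desc`). Since
`so`-morphisms are order-epic (`IsSO.le_of_comp_le`), the order on descended maps is exactly the
relation `≼` on representatives. Taking quotients is therefore an equivalence.

Projective covers are treated as functors `G` rather than subcategories, so that a cover can be
transported along an equivalence: in the last claim both exact categories are exact completions of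
the same `P`. -/

namespace PosEnriched

open Limits

/-! ## Equivalences of `Pos`-categories -/

section Equivalence

universe v₃ u₃

variable {C : Type u₁} [Category.{v₁} C] [PosCategory C]
  {D : Type u₂} [Category.{v₂} D] [PosCategory D]
  {E : Type u₃} [Category.{v₃} E] [PosCategory E]

/-- A functor reflecting the order of the hom-posets. -/
def LocallyReflecting (F : C ⥤ D) : Prop :=
  ∀ ⦃X Y : C⦄ ⦃f g : X ⟶ Y⦄, F.map f ≤ F.map g → f ≤ g

theorem LocallyMonotone.comp {F : C ⥤ D} {G : D ⥤ E} (hF : LocallyMonotone F)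
    (hG : LocallyMonotone G) : LocallyMonotone (F ⋙ G) :=
  fun _ _ _ _ h => hG (hF h)

theorem LocallyReflecting.comp {F : C ⥤ D} {G : D ⥤ E} (hF : LocallyReflecting F)
    (hG : LocallyReflecting G) : LocallyReflecting (F ⋙ G) :=
  fun _ _ _ _ h => hF (hG h)

theorem LocallyReflecting.faithful {F : C ⥤ D} (hF : LocallyReflecting F) : F.Faithful :=
  ⟨fun h => le_antisymm (hF h.le) (hF h.ge)⟩

theorem le_of_comp_iso_le {X Y Z : C} {f g : X ⟶ Y} (i : Y ⟶ Z) [IsIso i]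
    (h : f ≫ i ≤ g ≫ i) : f ≤ g := by
  simpa using comp_mono h (le_refl (inv i))

theorem le_of_iso_comp_le {X Y Z : C} {f g : Y ⟶ Z} (i : X ⟶ Y) [IsIso i]
    (h : i ≫ f ≤ i ≫ g) : f ≤ g := by
  simpa using comp_mono (le_refl (inv i)) h

def PosEquivalence.symm (e : PosEquivalence C D) : PosEquivalence D C where
  equiv := e.equiv.symm
  functor_mono := e.inverse_mono
  inverse_mono := e.functor_mono

def PosEquivalence.trans (e : PosEquivalence C D) (e' : PosEquivalence D E) :
    PosEquivalence C E where
  equiv := e.equiv.trans e'.equiv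
  functor_mono := e.functor_mono.comp e'.functor_mono
  inverse_mono := e'.inverse_mono.comp e.inverse_mono

theorem PosEquivalence.functor_reflecting (e : PosEquivalence C D) :
    LocallyReflecting e.equiv.functor := by
  intro X Y f g h
  have h' := e.inverse_mono h
  rw [e.equiv.inv_fun_map, e.equiv.inv_fun_map] at h'
  exact le_of_comp_iso_le _ (le_of_iso_comp_le _ h')

/-- Applied to the image of `f` under the inverse, `F` returns a conjugate of `f` by the counit, so
order reflection by `F` gives monotonicity of the inverse. -/
theorem nonempty_posEquivalence_of_isEquivalence (F : C ⥤ D) [F.IsEquivalence]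
    (hF : LocallyMonotone F) (hF' : LocallyReflecting F) : Nonempty (PosEquivalence C D) := by
  refine ⟨⟨F.asEquivalence, hF, fun X Y f g h => hF' ?_⟩⟩
  change F.asEquivalence.functor.map _ ≤ F.asEquivalence.functor.map _
  rw [F.asEquivalence.fun_inv_map, F.asEquivalence.fun_inv_map]
  exact comp_mono (le_refl _) (comp_mono h (le_refl _))

end Equivalence

/-! ### Products and inserters as weighted limits -/

section FiniteLimits

variable {C : Type u₁} [Category.{v₁} C] [PosCategory C]

/-- The `Pos`-category structure with discrete hom-posets. -/
abbrev discreteHomPosCategory (J : Type) [Category.{0} J] : PosCategory J where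
  homOrder X Y :=
    { le := fun f g => f = g
      le_refl := fun _ => rfl
      le_trans := fun _ _ _ h h' => h.trans h'
      le_antisymm := fun _ _ h _ => h }
  comp_le_comp := by
    rintro _ _ _ _ _ _ _ rfl rfl
    rfl

theorem HasFiniteWeightedLimits.exists_product (h : HasFiniteWeightedLimits C) (X Y : C) :
    ∃ (L : C) (p : L ⟶ X) (q : L ⟶ Y),
      (∀ ⦃T : C⦄ (a : T ⟶ X) (b : T ⟶ Y), ∃ u : T ⟶ L, u ≫ p = a ∧ u ≫ q = b) ∧
      ∀ ⦃T : C⦄ (u v : T ⟶ L), u ≫ p ≤ v ≫ p → u ≫ q ≤ v ≫ q → u ≤ v := by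
  let _ : PosCategory (Discrete WalkingPair) := discreteHomPosCategory _
  let W : Discrete WalkingPair ⥤ PartOrd.{0} := (Functor.const _).obj (PartOrd.of PUnit)
  have hW : IsFiniteWeight W :=
    { locallyMonotone := fun _ _ _ _ _ => le_refl _
      finite_objects := inferInstance
      finite_homs := fun _ _ => inferInstance
      finite_values := fun _ => inferInstanceAs (Finite PUnit) }
  have hD : LocallyMonotone (pair X Y) := by
    intro i j a b _
    rw [Subsingleton.elim a b]
  obtain ⟨L, c, hc, hc'⟩ := h _ W (pair X Y) hW hD
  refine ⟨L, c.leg ⟨.left⟩ PUnit.unit, c.leg ⟨.right⟩ PUnit.unit, ?_, ?_⟩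
  · intro T a b
    let d : WeightedCone W (pair X Y) T :=
      { leg := fun j _ => match j with
          | ⟨.left⟩ => a
          | ⟨.right⟩ => b
        leg_mono := fun _ _ _ _ => le_refl _
        naturality := by
          rintro ⟨i⟩ ⟨j⟩ f _
          obtain rfl : i = j := Discrete.eq_of_hom f
          obtain rfl : f = 𝟙 _ := Subsingleton.elim _ _
          simp }
    obtain ⟨u, hu⟩ := hc T d
    exact ⟨u, hu ⟨.left⟩ PUnit.unit, hu ⟨.right⟩ PUnit.unit⟩
  · intro T u v hp hq
    refine hc' T u v ?_
    rintro ⟨_ | _⟩ ⟨⟩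
    · exact hp
    · exact hq

/-- Inserters serve twice: to show that `so`-morphisms are order-epic, and, on a product, to build
order kernels. -/
theorem HasFiniteWeightedLimits.exists_inserter (h : HasFiniteWeightedLimits C) {X Y : C}
    (f g : X ⟶ Y) :
    ∃ (L : C) (m : L ⟶ X), IsFF m ∧ m ≫ f ≤ m ≫ g ∧
      ∀ ⦃T : C⦄ (a : T ⟶ X), a ≫ f ≤ a ≫ g → ∃ u : T ⟶ L, u ≫ m = a := by
  let _ : PosCategory WalkingParallelPair := discreteHomPosCategory _
  -- The two points of `false < true` are picked out by the parallel arrows, so a cone is a map `a`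
  -- with `a ≫ f ≤ a ≫ g`.
  let W : WalkingParallelPair ⥤ PartOrd.{0} :=
    parallelPair (X := PartOrd.of PUnit) (Y := PartOrd.of Bool)
      (PartOrd.ofHom ⟨fun _ => false, fun _ _ _ => le_refl _⟩)
      (PartOrd.ofHom ⟨fun _ => true, fun _ _ _ => le_refl _⟩)
  have hW : IsFiniteWeight W :=
    { locallyMonotone := by
        rintro _ _ _ _ rfl
        rfl
      finite_objects := inferInstance
      finite_homs := fun _ _ => inferInstance
      finite_values := by
        rintro (_ | _)
        · exact inferInstanceAs (Finite PUnit)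
        · exact inferInstanceAs (Finite Bool) }
  have hD : LocallyMonotone (parallelPair f g) := by
    rintro _ _ _ _ rfl
    rfl
  obtain ⟨L, c, hc, hc'⟩ := h _ W (parallelPair f g) hW hD
  have hl : c.leg .one false = c.leg .zero PUnit.unit ≫ f :=
    c.naturality WalkingParallelPairHom.left PUnit.unit
  have hr : c.leg .one true = c.leg .zero PUnit.unit ≫ g :=
    c.naturality WalkingParallelPairHom.right PUnit.unit
  have hle : c.leg .zero PUnit.unit ≫ f ≤ c.leg .zero PUnit.unit ≫ g := by
    rw [← hl, ← hr]
    exact c.leg_mono .one (show false ≤ true from Bool.false_le _)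
  refine ⟨L, c.leg .zero PUnit.unit, ?_, hle, ?_⟩
  · intro T u v huv
    refine hc' T u v ?_
    rintro (_ | _) w
    · exact huv
    · have huf := comp_mono huv (le_refl f)
      have hug := comp_mono huv (le_refl g)
      simp only [Category.assoc] at huf hug
      rcases w with _ | _
      · exact hl ▸ huf
      · exact hr ▸ hug
  · intro T a ha
    let d : WeightedCone W (parallelPair f g) T :=
      { leg := fun j => match j with
          | .zero => fun _ => a
          | .one => fun w : Bool => bif w then a ≫ g else a ≫ f
        leg_mono := by
          rintro (_ | _)
          · exact fun _ _ _ => le_refl _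
          · rintro (_ | _) (_ | _) hw
            · exact le_refl _
            · exact ha
            · exact absurd hw (by decide)
            · exact le_refl _
        naturality := by
          rintro _ _ (_ | _ | _) w
          · rfl
          · rfl
          · exact (by simp) }
    obtain ⟨u, hu⟩ := hc T d
    exact ⟨u, hu .zero PUnit.unit⟩

end FiniteLimits

/-! ## `so`-morphisms -/

section SO

variable {C : Type u₁} [Category.{v₁} C] [PosCategory C]

/-- The inserter of `u` and `v` is an `ff`-morphism through which `e` factors, so the diagonal
filler against `𝟙 B` splits it. -/
theorem IsSO.le_of_comp_le (hC : HasFiniteWeightedLimits C) {A B : C} {e : A ⟶ B} (he : IsSO e)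
    {Z : C} {u v : B ⟶ Z} (h : e ≫ u ≤ e ≫ v) : u ≤ v := by
  obtain ⟨L, m, hm, hle, hlift⟩ := hC.exists_inserter u v
  obtain ⟨a, ha⟩ := hlift e h
  obtain ⟨d, -, hd⟩ := (he m hm).1 a (𝟙 B) (by simpa using ha)
  have := comp_mono (le_refl d) hle
  rwa [← Category.assoc, ← Category.assoc, hd, Category.id_comp, Category.id_comp] at this

theorem IsSO.eq_of_comp_eq (hC : HasFiniteWeightedLimits C) {A B : C} {e : A ⟶ B} (he : IsSO e)
    {Z : C} {u v : B ⟶ Z} (h : e ≫ u = e ≫ v) : u = v :=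
  le_antisymm (he.le_of_comp_le hC h.le) (he.le_of_comp_le hC h.ge)

theorem IsSO.iso_comp {A A' B : C} (i : A' ⟶ A) [IsIso i] {e : A ⟶ B} (he : IsSO e) :
    IsSO (i ≫ e) := by
  intro X Y m hm
  refine ⟨fun a b hab => ?_, fun d d' h h' => ?_⟩
  · obtain ⟨d, hd, hd'⟩ := (he m hm).1 (inv i ≫ a) b (by simp [hab])
    exact ⟨d, by simp [hd], hd'⟩
  · refine (he m hm).2 d d' (le_of_iso_comp_le i ?_) h'
    simpa using h

end SO

/-! ## Projective covers as functors -/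

section Cover

variable {C : Type u₁} [Category.{v₁} C] [PosCategory C]
  {E : Type u₂} [Category.{v₂} E] [PosCategory E]

/-- A `Pos`-functor which is fully faithful on hom-posets and whose image is a projective cover. -/
structure IsProjectiveCoverFunctor (G : C ⥤ E) : Prop where
  full : G.Full
  mono : LocallyMonotone G
  reflecting : LocallyReflecting G
  projective : ∀ X : C, IsSOProjective (G.obj X)
  enough : ∀ A : E, ∃ (X : C) (e : G.obj X ⟶ A), IsSO e

theorem IsProjectiveCover.isProjectiveCoverFunctor_ι {P : ObjectProperty E}
    (hP : IsProjectiveCover P) : IsProjectiveCoverFunctor P.ι where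
  full := inferInstance
  mono _ _ _ _ h := h
  reflecting _ _ _ _ h := h
  projective X := hP.projective X.obj X.property
  enough A := by
    obtain ⟨X, e, hX, he⟩ := hP.enough A
    exact ⟨⟨X, hX⟩, e, he⟩

variable {G : C ⥤ E}

theorem IsProjectiveCoverFunctor.precomp {D : Type*} [Category D] [PosCategory D]
    (hG : IsProjectiveCoverFunctor G) (e : PosEquivalence D C) :
    IsProjectiveCoverFunctor (e.equiv.functor ⋙ G) where
  full := by
    have := hG.full
    infer_instance
  mono := e.functor_mono.comp hG.mono
  reflecting := e.functor_reflecting.comp hG.reflecting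
  projective X := hG.projective _
  enough A := by
    obtain ⟨X, f, hf⟩ := hG.enough A
    exact ⟨e.equiv.inverse.obj X, G.map (e.equiv.counit.app X) ≫ f, hf.iso_comp _⟩

/-! ### Lifting through covers and weak limits -/

namespace IsProjectiveCoverFunctor

theorem exists_map_eq (hG : IsProjectiveCoverFunctor G) {X Y : C} (f : G.obj X ⟶ G.obj Y) :
    ∃ g : X ⟶ Y, G.map g = f :=
  hG.full.map_surjective f

theorem map_injective (hG : IsProjectiveCoverFunctor G) {X Y : C} {f g : X ⟶ Y}
    (h : G.map f = G.map g) : f = g :=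
  have := hG.reflecting.faithful
  G.map_injective h

theorem exists_map_lift (hG : IsProjectiveCoverFunctor G) {X Y : C} {A : E} {e : G.obj Y ⟶ A}
    (he : IsSO e) (f : G.obj X ⟶ A) : ∃ g : X ⟶ Y, G.map g ≫ e = f := by
  obtain ⟨u, hu⟩ := hG.projective X e he f
  obtain ⟨g, rfl⟩ := hG.exists_map_eq u
  exact ⟨g, hu⟩

/-- Cover the true limit in `E` by some `G X`: cones still factor, by projectivity, but no longer
uniquely. -/
theorem weaklyLex (hG : IsProjectiveCoverFunctor G) (hE : HasFiniteWeightedLimits E) :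
    WeaklyLex C where
  exists_weakLimit J _ _ W D hW hD := by
    obtain ⟨L, c, hc, -⟩ := hE J W (D ⋙ G) hW (hD.comp hG.mono)
    obtain ⟨X, e, he⟩ := hG.enough L
    choose leg hleg using fun j w => hG.exists_map_eq (e ≫ c.leg j w)
    refine ⟨X, ⟨leg, fun j w w' h => hG.reflecting ?_, fun i j f w => hG.map_injective ?_⟩, ?_⟩
    · rw [hleg, hleg]
      exact comp_mono (le_refl e) (c.leg_mono j h)
    · rw [G.map_comp, hleg, hleg, c.naturality, Category.assoc]
      rfl
    · intro Y a
      obtain ⟨h, hh⟩ := hc (G.obj Y)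
        ⟨fun j w => G.map (a.leg j w), fun j w w' h => hG.mono (a.leg_mono j h),
          fun i j f w => by
            rw [a.naturality, G.map_comp]
            rfl⟩
      obtain ⟨g, hg⟩ := hG.exists_map_lift he h
      refine ⟨g, fun j w => hG.map_injective ?_⟩
      rw [G.map_comp, hleg, ← Category.assoc, hg, hh]

/-- A morphism out of the codomain of an `so`-morphism `q` is the same as a morphism out of its
domain which respects the order kernel of `q`. -/
theorem exists_desc (hG : IsProjectiveCoverFunctor G) (hE : IsRegular E) {X : C} {Q Z : E}
    {q : G.obj X ⟶ Q} (hq : IsSO q) (g : G.obj X ⟶ Z)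
    (h : ∀ ⦃A : C⦄ (x y : A ⟶ X), G.map x ≫ q ≤ G.map y ≫ q → G.map x ≫ g ≤ G.map y ≫ g) :
    ∃ d : Q ⟶ Z, q ≫ d = g := by
  -- The image `I` of `(q, g)` in `Q × Z` will be the graph of the desired map.
  obtain ⟨L, p₀, p₁, hlift, hle⟩ := hE.lex.exists_product Q Z
  obtain ⟨k, hk₀, hk₁⟩ := hlift q g
  obtain ⟨I, s, m, hs, hm, rfl⟩ := hE.factorization k
  have hff : IsFF (m ≫ p₀) := by
    intro T u v huv
    -- On a projective cover of `T`, elements of `I` lift to elements of `X`, where `h` applies; `t`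
    -- is then cancelled as an order-epi.
    obtain ⟨A, t, ht⟩ := hG.enough T
    obtain ⟨x, hx⟩ := hG.exists_map_lift hs (t ≫ u)
    obtain ⟨y, hy⟩ := hG.exists_map_lift hs (t ≫ v)
    have hxq : ∀ (z : A ⟶ X) (w : T ⟶ I), G.map z ≫ s = t ≫ w →
        t ≫ w ≫ m ≫ p₀ = G.map z ≫ q ∧ t ≫ w ≫ m ≫ p₁ = G.map z ≫ g := by
      intro z w hz
      rw [← hk₀, ← hk₁, ← Category.assoc, ← Category.assoc t, ← hz]
      simp
    have hxy : G.map x ≫ q ≤ G.map y ≫ q := by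
      rw [← (hxq x u hx).1, ← (hxq y v hy).1]
      exact comp_mono (le_refl t) huv
    have hxy' := h x y hxy
    rw [← (hxq x u hx).2, ← (hxq y v hy).2] at hxy'
    refine hm u v (hle _ _ ?_ ?_)
    · simpa using huv
    · simpa using ht.le_of_comp_le hE.lex hxy'
  -- As `q` factors through the `ff`-morphism `m ≫ p₀`, the filler `d` is a section of it.
  obtain ⟨d, hd, -⟩ := (hq _ hff).1 s (𝟙 Q) (by simpa using hk₀)
  refine ⟨d ≫ m ≫ p₁, ?_⟩
  rw [← Category.assoc, hd, ← hk₁, Category.assoc]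

/-- `q` is a quotient of `G X` by the pseudocongruence `R`. -/
structure IsQuotient (G : C ⥤ E) (R : Pseudocongruence C) {Q : E} (q : G.obj R.X ⟶ Q) :
    Prop where
  isSO : IsSO q
  factors_iff : ∀ ⦃A : C⦄ (x y : A ⟶ R.X), Factors R.r₀ R.r₁ x y ↔ G.map x ≫ q ≤ G.map y ≫ q

/-- The image of `G R` in `G X × G X` has the same elements over projectives as `R`; being a
congruence can be tested on such elements. -/
theorem exists_isQuotient [WeaklyLex C] (hG : IsProjectiveCoverFunctor G) (hE : IsExact E)
    (R : Pseudocongruence C) : ∃ (Q : E) (q : G.obj R.X ⟶ Q), IsQuotient G R q := by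
  obtain ⟨L, p₀, p₁, hlift, hle⟩ := hE.lex.exists_product (G.obj R.X) (G.obj R.X)
  obtain ⟨k, hk₀, hk₁⟩ := hlift (G.map R.r₀) (G.map R.r₁)
  obtain ⟨I, s, m, hs, hm, rfl⟩ := hE.factorization k
  rw [Category.assoc] at hk₀ hk₁
  have hfac : ∀ ⦃A : C⦄ (x y : A ⟶ R.X), Factors R.r₀ R.r₁ x y ↔
      Factors (m ≫ p₀) (m ≫ p₁) (G.map x) (G.map y) := by
    intro A x y
    constructor
    · rintro ⟨u, rfl, rfl⟩
      exact ⟨G.map u ≫ s, by simp [hk₀], by simp [hk₁]⟩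
    · rintro ⟨u, hx, hy⟩
      obtain ⟨v, rfl⟩ := hG.exists_map_lift hs u
      refine ⟨v, hG.map_injective ?_, hG.map_injective ?_⟩
      · rw [← hx, G.map_comp, ← hk₀, Category.assoc]
      · rw [← hy, G.map_comp, ← hk₁, Category.assoc]
  -- Membership in the image descends along `so`-morphisms, by orthogonality to `m`.
  have hlocal : ∀ ⦃A T : E⦄ (t : A ⟶ T) (_ : IsSO t) (u v : T ⟶ G.obj R.X),
      Factors (m ≫ p₀) (m ≫ p₁) (t ≫ u) (t ≫ v) → Factors (m ≫ p₀) (m ≫ p₁) u v := by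
    rintro A T t ht u v ⟨w, hw₀, hw₁⟩
    obtain ⟨b, rfl, rfl⟩ := hlift u v
    have hwb : w ≫ m = t ≫ b :=
      le_antisymm (hle _ _ (by simp [hw₀]) (by simp [hw₁]))
        (hle _ _ (by simp [hw₀]) (by simp [hw₁]))
    obtain ⟨d, -, hd⟩ := (ht m hm).1 w b hwb
    exact ⟨d, by rw [← Category.assoc, hd], by rw [← Category.assoc, hd]⟩
  have hcong : IsCongruence (m ≫ p₀) (m ≫ p₁) := by
    refine ⟨fun u v h₀ h₁ => hm u v (hle _ _ (by simpa using h₀) (by simpa using h₁)), ?_, ?_, ?_⟩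
    · simpa using (hfac (𝟙 R.X) (𝟙 R.X)).1 (R.orderReflexive _ _ (le_refl _))
    · rintro T x y z ⟨w, rfl, rfl⟩ ⟨w', hw', rfl⟩
      obtain ⟨A, t, ht⟩ := hG.enough T
      obtain ⟨x', hx⟩ := hG.exists_map_eq (t ≫ w ≫ m ≫ p₀)
      obtain ⟨y', hy⟩ := hG.exists_map_eq (t ≫ w ≫ m ≫ p₁)
      obtain ⟨z', hz⟩ := hG.exists_map_eq (t ≫ w' ≫ m ≫ p₁)
      refine hlocal t ht _ _ ?_
      rw [← hx, ← hz, ← hfac]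
      refine R.factors_trans (y := y') ((hfac _ _).2 ?_) ((hfac _ _).2 ?_)
      · exact ⟨t ≫ w, by simp [hx], by simp [hy]⟩
      · exact ⟨t ≫ w', by simp [hy, hw'], by simp [hz]⟩
    · rintro T x y x' y' ⟨w, rfl, rfl⟩ hx hy
      obtain ⟨A, t, ht⟩ := hG.enough T
      obtain ⟨a, ha⟩ := hG.exists_map_eq (t ≫ w ≫ m ≫ p₀)
      obtain ⟨b, hb⟩ := hG.exists_map_eq (t ≫ w ≫ m ≫ p₁)
      obtain ⟨a', ha'⟩ := hG.exists_map_eq (t ≫ x')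
      obtain ⟨b', hb'⟩ := hG.exists_map_eq (t ≫ y')
      refine hlocal t ht _ _ ?_
      rw [← ha', ← hb', ← hfac]
      refine R.factors_trans (R.orderReflexive a' a (hG.reflecting ?_))
        (R.factors_trans (y := b) ((hfac _ _).2 ⟨t ≫ w, by simp [ha], by simp [hb]⟩)
          (R.orderReflexive b b' (hG.reflecting ?_)))
      · rw [ha, ha']
        exact comp_mono (le_refl t) hx
      · rw [hb, hb']
        exact comp_mono (le_refl t) hy
  obtain ⟨Y, f, hf⟩ := hE.effective _ _ hcong
  -- Dropping the `ff`-part `n` does not change the order kernel.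
  obtain ⟨Q, q, n, hq, hn, rfl⟩ := hE.factorization f
  refine ⟨Q, q, hq, fun A x y => (hfac x y).trans ⟨?_, fun h => hf.lift _ _ ?_⟩⟩
  · rintro ⟨u, hx, hy⟩
    refine hn _ _ ?_
    rw [← hx, ← hy]
    simpa using comp_mono (le_refl u) hf.w
  · simpa using comp_mono h (le_refl n)

/-- A projective cover of the order kernel of `q` yields `R`; its axioms then reduce to reflexivity
and transitivity of `≤` after composing with `q`. -/
theorem exists_pseudocongruence (hG : IsProjectiveCoverFunctor G) (hE : HasFiniteWeightedLimits E)
    (A : E) : ∃ (R : Pseudocongruence C) (q : G.obj R.X ⟶ A), IsQuotient G R q := by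
  obtain ⟨X, q, hq⟩ := hG.enough A
  obtain ⟨L, p₀, p₁, hlift, hle⟩ := hE.exists_product (G.obj X) (G.obj X)
  obtain ⟨K, m, hm, hmle, hmlift⟩ := hE.exists_inserter (p₀ ≫ q) (p₁ ≫ q)
  obtain ⟨R, e, he⟩ := hG.enough K
  obtain ⟨r₀, hr₀⟩ := hG.exists_map_eq (e ≫ m ≫ p₀)
  obtain ⟨r₁, hr₁⟩ := hG.exists_map_eq (e ≫ m ≫ p₁)
  have hr : G.map r₀ ≫ q ≤ G.map r₁ ≫ q := by
    rw [hr₀, hr₁]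
    simpa using comp_mono (le_refl e) hmle
  have hfac : ∀ ⦃A : C⦄ (x y : A ⟶ X), Factors r₀ r₁ x y ↔ G.map x ≫ q ≤ G.map y ≫ q := by
    intro A x y
    constructor
    · rintro ⟨u, rfl, rfl⟩
      simpa using comp_mono (le_refl (G.map u)) hr
    · intro h
      obtain ⟨b, hb₀, hb₁⟩ := hlift (G.map x) (G.map y)
      obtain ⟨c, rfl⟩ := hmlift b (by rwa [← Category.assoc, ← Category.assoc, hb₀, hb₁])
      obtain ⟨u, rfl⟩ := hG.exists_map_lift he c
      refine ⟨u, hG.map_injective ?_, hG.map_injective ?_⟩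
      · rw [← hb₀, G.map_comp, hr₀]
        simp
      · rw [← hb₁, G.map_comp, hr₁]
        simp
  refine ⟨⟨X, R, r₀, r₁, fun a₀ a₁ h => (hfac _ _).2 (comp_mono (hG.mono h) (le_refl q)), ?_⟩,
    q, hq, hfac⟩
  intro RR d₀ d₁ hd
  refine (hfac (d₀ ≫ r₀) (d₁ ≫ r₁)).2 (((hfac _ _).1 ⟨d₀, rfl, rfl⟩).trans ?_)
  rw [hd.w]
  exact (hfac _ _).1 ⟨d₁, rfl, rfl⟩

/-! ### Maps between quotients and the equivalence -/

theorem nonempty_iso_of_isQuotient (hG : IsProjectiveCoverFunctor G) (hE : IsRegular E)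
    {R : Pseudocongruence C} {Q Q' : E} {q : G.obj R.X ⟶ Q} {q' : G.obj R.X ⟶ Q'}
    (hq : IsQuotient G R q) (hq' : IsQuotient G R q') : Nonempty (Q ≅ Q') := by
  obtain ⟨d, hd⟩ := hG.exists_desc hE hq.isSO q'
    fun _ x y h => (hq'.factors_iff x y).1 ((hq.factors_iff x y).2 h)
  obtain ⟨d', hd'⟩ := hG.exists_desc hE hq'.isSO q
    fun _ x y h => (hq.factors_iff x y).1 ((hq'.factors_iff x y).2 h)
  refine ⟨d, d', hq.isSO.eq_of_comp_eq hE.lex ?_, hq'.isSO.eq_of_comp_eq hE.lex ?_⟩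
  · rw [← Category.assoc, hd, hd', Category.comp_id]
  · rw [← Category.assoc, hd', hd, Category.comp_id]

theorem exists_quotient_map (hG : IsProjectiveCoverFunctor G) (hE : IsRegular E)
    {R S : Pseudocongruence C} {Q Q' : E} {q : G.obj R.X ⟶ Q} {q' : G.obj S.X ⟶ Q'}
    (hq : IsQuotient G R q) (hq' : IsQuotient G S q') (f : PreHom R S) :
    ∃ d : Q ⟶ Q', q ≫ d = G.map f.f ≫ q' := by
  refine hG.exists_desc hE hq.isSO _ fun A x y h => ?_
  obtain ⟨u, rfl, rfl⟩ := (hq.factors_iff x y).2 h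
  obtain ⟨fbar, h₀, h₁⟩ := f.compat
  have := (hq'.factors_iff (u ≫ R.r₀ ≫ f.f) (u ≫ R.r₁ ≫ f.f)).1
    ⟨u ≫ fbar, by simp [h₀], by simp [h₁]⟩
  simpa using this

theorem exists_preHom (hG : IsProjectiveCoverFunctor G)
    {R S : Pseudocongruence C} {Q Q' : E} {q : G.obj R.X ⟶ Q} {q' : G.obj S.X ⟶ Q'}
    (hq : IsQuotient G R q) (hq' : IsQuotient G S q') (d : Q ⟶ Q') :
    ∃ f : PreHom R S, q ≫ d = G.map f.f ≫ q' := by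
  obtain ⟨f, hf⟩ := hG.exists_map_lift hq'.isSO (q ≫ d)
  refine ⟨⟨f, (hq'.factors_iff (R.r₀ ≫ f) (R.r₁ ≫ f)).2 ?_⟩, hf.symm⟩
  have hR := (hq.factors_iff R.r₀ R.r₁).1 ⟨𝟙 _, by simp, by simp⟩
  simpa [hf] using comp_mono hR (le_refl d)

/-- The exact completion of the domain of a projective cover functor into an exact category is
equivalent to the codomain. -/
theorem nonempty_posEquivalence [WeaklyLex C] (hG : IsProjectiveCoverFunctor G)
    (hE : IsExact E) : Nonempty (PosEquivalence (ExactCompletion C) E) := by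
  choose Q q hq using fun R : ExactCompletion C => hG.exists_isQuotient hE R.toPseudocongruence
  -- This comparison yields functoriality, order preservation and reflection, and independence of
  -- chosen representatives.
  have hle : ∀ {R S : ExactCompletion C}
      (f g : PreHom R.toPseudocongruence S.toPseudocongruence) (d d' : Q R ⟶ Q S),
      q R ≫ d = G.map f.f ≫ q S → q R ≫ d' = G.map g.f ≫ q S → (f ≤ g ↔ d ≤ d') := by
    intro R S f g d d' hd hd'
    refine ((hq S).factors_iff f.f g.f).trans ?_
    rw [← hd, ← hd']
    exact ⟨(hq R).isSO.le_of_comp_le hE.lex, comp_mono (le_refl _)⟩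
  have hmap : ∀ (R S : ExactCompletion C) (φ : R ⟶ S), ∃ d : Q R ⟶ Q S,
      ∃ f : PreHom R.toPseudocongruence S.toPseudocongruence,
        toAntisymmetrization (· ≤ ·) f = φ ∧ q R ≫ d = G.map f.f ≫ q S := by
    rintro R S ⟨f⟩
    obtain ⟨d, hd⟩ := hG.exists_quotient_map hE.toIsRegular (hq R) (hq S) f
    exact ⟨d, f, rfl, hd⟩
  choose map rep hrep hmap using hmap
  let F : ExactCompletion C ⥤ E :=
    { obj := Q
      map := fun {R S} φ => map R S φ
      map_id := fun R => by
        have h := hmap R R (𝟙 R)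
        have hid : AntisymmRel (· ≤ ·) (rep R R (𝟙 R)) (PreHom.id R.toPseudocongruence) :=
          Quotient.exact (hrep R R (𝟙 R))
        have hid' : q R ≫ 𝟙 (Q R) = G.map (PreHom.id R.toPseudocongruence).f ≫ q R := by
          simp [PreHom.id]
        exact le_antisymm ((hle _ _ _ _ h hid').1 hid.1) ((hle _ _ _ _ hid' h).1 hid.2)
      map_comp := fun {R S T} φ ψ => by
        have h := hmap R T (φ ≫ ψ)
        have hc : AntisymmRel (· ≤ ·) (rep R T (φ ≫ ψ)) ((rep R S φ).comp (rep S T ψ)) := by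
          refine Quotient.exact ((hrep R T (φ ≫ ψ)).trans ?_)
          conv_lhs => rw [← hrep R S φ, ← hrep S T ψ]
          rfl
        have hc' : q R ≫ map R S φ ≫ map S T ψ =
            G.map ((rep R S φ).comp (rep S T ψ)).f ≫ q T := by
          rw [← Category.assoc, hmap, Category.assoc, hmap]
          simp [PreHom.comp]
        exact le_antisymm ((hle _ _ _ _ h hc').1 hc.1) ((hle _ _ _ _ hc' h).1 hc.2) }
  have hF : ∀ {R S : ExactCompletion C} (φ ψ : R ⟶ S), φ ≤ ψ ↔ F.map φ ≤ F.map ψ := by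
    intro R S φ ψ
    refine Iff.trans ?_ (hle _ _ _ _ (hmap R S φ) (hmap R S ψ))
    conv_lhs => rw [← hrep R S φ, ← hrep R S ψ]
    rfl
  have hF' : LocallyReflecting F := fun _ _ _ _ => (hF _ _).2
  have : F.Faithful := hF'.faithful
  have : F.Full := by
    refine ⟨fun {R S} d => ?_⟩
    obtain ⟨f, hf⟩ := hG.exists_preHom (hq R) (hq S) d
    refine ⟨toAntisymmetrization (· ≤ ·) f, ?_⟩
    have h := hmap R S (toAntisymmetrization (· ≤ ·) f)
    have hf' : AntisymmRel (· ≤ ·) (rep R S (toAntisymmetrization (· ≤ ·) f)) f :=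
      Quotient.exact (hrep R S (toAntisymmetrization (· ≤ ·) f))
    exact le_antisymm ((hle _ _ _ _ h hf).1 hf'.1) ((hle _ _ _ _ hf h).1 hf'.2)
  have : F.EssSurj := by
    refine ⟨fun A => ?_⟩
    obtain ⟨R, r, hr⟩ := hG.exists_pseudocongruence hE.lex A
    -- `A` and the chosen `Q` are both quotients of the same pseudocongruence.
    exact ⟨⟨R⟩, hG.nonempty_iso_of_isQuotient hE.toIsRegular (hq ⟨R⟩) hr⟩
  have : F.IsEquivalence := { }
  exact nonempty_posEquivalence_of_isEquivalence F (fun _ _ _ _ => (hF _ _).1) hF'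

end IsProjectiveCoverFunctor

end Cover

end PosEnriched

/-- If `E` is an exact `Pos`-category and `P` is a projective cover of `E`, then `P` is weakly lex
and its exact completion is equivalent to `E`. Consequently two exact `Pos`-categories with
equivalent projective covers are equivalent. -/
theorem mainTheorem3 :
    (∀ (E : Type u₁) [Category.{v₁} E] [PosEnriched.PosCategory E] (P : ObjectProperty E),
      PosEnriched.IsExact E → PosEnriched.IsProjectiveCover P →
        ∃ _ : PosEnriched.WeaklyLex P.FullSubcategory,
          Nonempty (PosEnriched.PosEquivalence
            (PosEnriched.ExactCompletion P.FullSubcategory) E)) ∧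
    (∀ (E : Type u₁) [Category.{v₁} E] [PosEnriched.PosCategory E] (P : ObjectProperty E)
        (F : Type u₂) [Category.{v₂} F] [PosEnriched.PosCategory F] (Q : ObjectProperty F),
      PosEnriched.IsExact E → PosEnriched.IsProjectiveCover P →
      PosEnriched.IsExact F → PosEnriched.IsProjectiveCover Q →
        Nonempty (PosEnriched.PosEquivalence P.FullSubcategory Q.FullSubcategory) →
          Nonempty (PosEnriched.PosEquivalence E F)) := by
  refine ⟨fun E _ _ P hE hP => ?_, fun E _ _ P F _ _ Q hE hP hF hQ ⟨e⟩ => ?_⟩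
  · have hι := hP.isProjectiveCoverFunctor_ι
    have hlex := hι.weaklyLex hE.lex
    exact ⟨hlex, hι.nonempty_posEquivalence hE⟩
  · have hι := hP.isProjectiveCoverFunctor_ι
    have hlex := hι.weaklyLex hE.lex
    obtain ⟨a⟩ := hι.nonempty_posEquivalence hE
    -- Along `e`, `P` becomes a projective cover of `F` too.
    obtain ⟨b⟩ := (hQ.isProjectiveCoverFunctor_ι.precomp e).nonempty_posEquivalence hF
    exact ⟨a.symm.trans b⟩
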